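/- Let $k$ be an algebraically closed field and let $K_0(\mathrm{Var}_k)$ be the Grothendieck ring of varieties over $k$. Let $(X,0)$ be a reduced curve singularity over $k$ with $s\ge 1$ branches, i.e. $X=\operatorname{Spec} R$ with $R$ a reduced complete Noetherian local $k$-algebra of dimension $1$ with residue field $k$, and identify its normalization with $\tilde R=\prod_{i=1}^s k[[x_i]]\supset R$. Write $\varphi_i: B_i=\operatorname{Spec}k[[x_i]]\to X$ for the restriction of the normalization map to the $i$-th branch. Let $\mathfrak c=\operatorname{Ann}_R(\tilde R/R)$ be the conductor ideal and let the conductor $c_i$ of the $i$-th branch be the least integer $c\ge 0$ such that $x_i^{c}\in\mathfrak c$, where $x_i^c$ denotes the element of $\tilde R$ with $i$-th component $x_i^c$ and all other components $0$. For $d\ge 0$ let $\operatorname{Hilb}^d(X,0)$ be the punctual Hilbert scheme, whose closed points are the ideals $\mathcal I\subset R$ of colength $d$, and for $\underline a\in\mathbb N^s$ let $\operatorname{Hilb}^{d,\underline a}(X,0)\subset\operatorname{Hilb}^d(X,0)$ be the locally closed subvariety of those $[\mathcal I]$ such that $\varphi_i^{*}\operatorname{Spec}(R/\mathcal I)$ has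 length $a_i$ for all $i=1,\dots,s$. Then for all $\underline a'=(a_1,\dots,a_{s-1})\in\mathbb N^{s-1}$, all $d\ge 0$ and all $e\ge c_s$, $$[\operatorname{Hilb}^{d,(\underline a',e)}(X,0)]=[\operatorname{Hilb}^{d+1,(\underline a',e+1)}(X,0)]\quad\text{in } K_0(\mathrm{Var}_k).$$ -/

import Mathlib

open CategoryTheory AlgebraicGeometry MonoidalCategory TopologicalSpace
open scoped PowerSeries

universe u v

/-! ### The Grothendieck ring of varieties -/

section GrothendieckRing

variable (k : Type u) [Field k]

/-- A `k`-scheme that is separated and of finite type. -/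
def IsVariety : ObjectProperty (Over (Spec (CommRingCat.of k))) := fun X =>
  IsSeparated X.hom ∧ LocallyOfFiniteType X.hom ∧ QuasiCompact X.hom

instance : (IsVariety k).IsMonoidal where
  prop_unit := by
    refine ⟨?_, ?_, ?_⟩ <;> (dsimp; infer_instance)
  prop_tensor X Y hX hY := by
    obtain ⟨_, _, _⟩ := hX
    obtain ⟨_, _, _⟩ := hY
    refine ⟨?_, ?_, ?_⟩ <;> (rw [Over.tensorObj_hom]; infer_instance)

/-- The category of varieties over `k` (separated `k`-schemes of finite type); its monoidal
structure is the fibre product over `k`. -/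
abbrev Var := (IsVariety k).FullSubcategory

/-- The free commutative ring on isomorphism classes of varieties, with `[X] * [Y] = [X ×ₖ Y]`. -/
abbrev PreK0 := MonoidAlgebra ℤ (Skeleton (Var k))

variable {k} in
/-- The generator attached to a variety. -/
noncomputable def PreK0.of (X : Var k) : PreK0 k := MonoidAlgebra.of ℤ _ (toSkeleton X)

/-- The scissor relations `[X] - [Z] - [U]`, for `Z` closed in `X` with open complement `U`. -/
def scissorRelations : Set (PreK0 k) :=
  {r | ∃ (X Z U : Var k) (i : Z ⟶ X) (j : U ⟶ X),
    IsClosedImmersion i.hom.left ∧ IsOpenImmersion j.hom.left ∧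
    IsCompl (Set.range i.hom.left) (Set.range j.hom.left) ∧
    r = PreK0.of X - PreK0.of Z - PreK0.of U}

/-- The Grothendieck ring of varieties over `k`. -/
abbrev K0Var := PreK0 k ⧸ Ideal.span (scissorRelations k)

variable {k} in
/-- The class of a variety in the Grothendieck ring. -/
noncomputable def K0Var.mk (X : Var k) : K0Var k := Ideal.Quotient.mk _ (PreK0.of X)

end GrothendieckRing

/-! ### Locally closed subvarieties of projective space -/

section Projective

variable (k : Type u) [Field k] (σ : Type) [Finite σ]

/-- The standard grading of `k[p_j : j ∈ σ]`. -/
abbrev coordGrading : ℕ → Submodule k (MvPolynomial σ k) := MvPolynomial.homogeneousSubmodule σ k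

attribute [local instance] MvPolynomial.gradedAlgebra

/-- The structure morphism of the projective space `Proj k[p_j : j ∈ σ]` over `k`. -/
noncomputable def projSpaceHom : Proj (coordGrading k σ) ⟶ Spec (CommRingCat.of k) :=
  Proj.toSpecZero (coordGrading k σ) ≫
    Spec.map (CommRingCat.ofHom (algebraMap k (coordGrading k σ 0)))

lemma isVariety_projSpace : IsSeparated (projSpaceHom k σ) ∧
    LocallyOfFiniteType (projSpaceHom k σ) ∧ QuasiCompact (projSpaceHom k σ) := by
  have hsurj : Function.Surjective (algebraMap k (coordGrading k σ 0)) := by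
    rintro ⟨f, hf⟩
    rw [coordGrading, MvPolynomial.mem_homogeneousSubmodule,
      ← MvPolynomial.totalDegree_zero_iff_isHomogeneous] at hf
    refine ⟨MvPolynomial.coeff 0 f, Subtype.ext ?_⟩
    exact (MvPolynomial.totalDegree_eq_zero_iff_eq_C.mp hf).symm
  have : IsClosedImmersion
      (Spec.map (CommRingCat.ofHom (algebraMap k (coordGrading k σ 0)))) :=
    IsClosedImmersion.spec_of_surjective _ hsurj
  have : IsScalarTower k (coordGrading k σ 0) (MvPolynomial σ k) :=
    IsScalarTower.of_algebraMap_eq' (R := k) (S := coordGrading k σ 0) (A := MvPolynomial σ k) rfl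
  have : Algebra.FiniteType (coordGrading k σ 0) (MvPolynomial σ k) :=
    Algebra.FiniteType.of_restrictScalars_finiteType k _ _
  refine ⟨?_, ?_, ?_⟩ <;> (dsimp only [projSpaceHom]; infer_instance)

variable {k σ}

/-- The point `x` of projective space is the `k`-rational point with homogeneous coordinates `p`:
a homogeneous polynomial vanishes at `x` iff it vanishes at `p`. -/
def HasHomogeneousCoords (x : Proj (coordGrading k σ)) (p : σ → k) : Prop :=
  ∀ (n : ℕ), ∀ f ∈ coordGrading k σ n,
    f ∈ (show ProjectiveSpectrum (coordGrading k σ) from x).asHomogeneousIdeal ↔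
      MvPolynomial.eval p f = 0

/-- For a set `D` of closed points, the closed set of boundary points: the closure of the
closed points that are in the closure of `D` but not in `D`. -/
def boundaryOf {X : Scheme.{u}} (D : Set X) : Closeds X :=
  ⟨closure ({x | x ∈ closure D ∧ IsClosed {x}} \ D), isClosed_closure⟩

/-- The open complement of `boundaryOf D`. -/
def complOf {X : Scheme.{u}} (D : Set X) : X.Opens := (boundaryOf D).compl

/-- For a set `D` of closed points that is locally closed among the closed points: the
locally closed subset `closure D \ boundaryOf D`, whose closed points are the elements of `D`,
with its reduced scheme structure. It is a closed subscheme of the open complement of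
`boundaryOf D`. -/
noncomputable def reducedSubscheme {X : Scheme.{u}} (D : Set X) : Scheme.{u} :=
  (Scheme.IdealSheafData.vanishingIdeal
    ((Closeds.closure D).preimage ((complOf D).ι).continuous)).subscheme

/-- The inclusion of `reducedSubscheme D`. -/
noncomputable def reducedSubschemeι {X : Scheme.{u}} (D : Set X) : reducedSubscheme D ⟶ X :=
  (Scheme.IdealSheafData.vanishingIdeal
    ((Closeds.closure D).preimage ((complOf D).ι).continuous)).subschemeι ≫
    (complOf D).ι

instance {X : Scheme.{u}} (D : Set X) : IsImmersion (reducedSubschemeι D) :=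
  inferInstanceAs (IsImmersion ((Scheme.IdealSheafData.vanishingIdeal
    ((Closeds.closure D).preimage ((complOf D).ι).continuous)).subschemeι ≫ (complOf D).ι))

/-- The variety of a locally closed set `D` of closed points of projective space. -/
noncomputable def subvariety (D : Set (Proj (coordGrading k σ))) : Var k where
  obj := Over.mk (reducedSubschemeι D ≫ projSpaceHom k σ)
  property := by
    obtain ⟨_, _, _⟩ := isVariety_projSpace k σ
    have : IsLocallyNoetherian (Proj (coordGrading k σ)) :=
      LocallyOfFiniteType.isLocallyNoetherian (projSpaceHom k σ)
    have : CompactSpace (Proj (coordGrading k σ)) :=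
      QuasiCompact.compactSpace_of_compactSpace (projSpaceHom k σ)
    have : IsNoetherian (Proj (coordGrading k σ)) := {}
    have : QuasiCompact (reducedSubschemeι D) :=
      have := (reducedSubschemeι D).isEmbedding.isInducing.noetherianSpace
      inferInstance
    refine ⟨?_, ?_, ?_⟩ <;> (dsimp only [Over.mk_hom]; infer_instance)

end Projective

/-! ### Curve singularities, branches and conductors -/

section Curve

variable (k : Type u) [Field k] (R : Type v) [CommRing R] [Algebra k R]

attribute [local instance] MvPolynomial.gradedAlgebra

/-- `R` is the complete local ring of a reduced curve singularity over `k`: a reduced complete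
Noetherian local `k`-algebra of dimension one with residue field `k`. -/
class IsCurveSingularity : Prop extends IsLocalRing R, IsNoetherianRing R, IsReduced R where
  isAdicComplete : IsAdicComplete (IsLocalRing.maximalIdeal R) R
  ringKrullDim_eq : ringKrullDim R = 1
  residue_bijective : Function.Bijective (algebraMap k (IsLocalRing.ResidueField R))

/-- The normalization of a curve singularity with `s` branches, the normalization being identified
with `k⟦x₁⟧ × ⋯ × k⟦xₛ⟧` : an injective, integral and birational `k`-algebra map. (The target is
integrally closed in its total ring of fractions, so it is the integral closure of `R` in its
total ring of fractions.) -/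
structure Normalization (s : ℕ) where
  toAlgHom : R →ₐ[k] (Fin s → k⟦X⟧)
  injective : Function.Injective toAlgHom
  isIntegral : toAlgHom.toRingHom.IsIntegral
  birational : ∀ y : Fin s → k⟦X⟧, ∃ a b : R,
    toAlgHom b ∈ nonZeroDivisors (Fin s → k⟦X⟧) ∧ toAlgHom b * y = toAlgHom a

namespace Normalization

variable {k R} {s : ℕ} (φ : Normalization k R s)

/-- The restriction of the normalization map to the `i`-th branch. -/
noncomputable def branch (i : Fin s) : R →+* k⟦X⟧ :=
  (Pi.evalRingHom (fun _ : Fin s => k⟦X⟧) i).comp φ.toAlgHom.toRingHom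

/-- The conductor ideal: the annihilator in `R` of the quotient of the normalization by `R`. -/
def conductorIdeal : Ideal R where
  carrier := {r | ∀ y : Fin s → k⟦X⟧, φ.toAlgHom r * y ∈ φ.toAlgHom.range}
  zero_mem' y := by simp
  add_mem' {a b} ha hb y := by
    rw [map_add, add_mul]
    exact add_mem (ha y) (hb y)
  smul_mem' c r hr y := by
    rw [smul_eq_mul, map_mul, mul_assoc]
    exact mul_mem ⟨c, rfl⟩ (hr y)

/-- The conductor `cᵢ` of the `i`-th branch: the least `c` such that `xᵢ ^ c` lies in the
conductor ideal, where `xᵢ ^ c` denotes the element with `i`-th component `xᵢ ^ c` and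
all other components `0`. -/
noncomputable def branchConductor (i : Fin s) : ℕ :=
  sInf {c | ∃ r ∈ φ.conductorIdeal, φ.toAlgHom r = Pi.single i (PowerSeries.X ^ c)}

/-- `I` has branch-length vector `a`: for every branch `Bᵢ → Spec R`, the pullback of the closed
subscheme `Spec (R / I)` to `Bᵢ` has length `aᵢ`. -/
def HasBranchLength (I : Ideal R) (a : Fin s → ℕ) : Prop :=
  ∀ i, Module.length k⟦X⟧ (k⟦X⟧ ⧸ I.map (φ.branch i)) = a i

end Normalization

/-! ### The branch-length strata of the punctual Hilbert scheme -/

variable [IsCurveSingularity k R]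

instance finite_quotient_pow (d : ℕ) :
    Module.Finite k (R ⧸ IsLocalRing.maximalIdeal R ^ d) := by
  classical
  set m := IsLocalRing.maximalIdeal R with hm
  have hdec : ∀ r : R, ∃ c : k, r - algebraMap k R c ∈ m := fun r => by
    obtain ⟨c, hc⟩ := (IsCurveSingularity.residue_bijective (k := k) (R := R)).2
      (IsLocalRing.residue R r)
    refine ⟨c, ?_⟩
    rw [hm, ← IsLocalRing.residue_eq_zero_iff, map_sub, ← hc, sub_eq_zero]
    rfl
  have key : ∀ n : ℕ, ∃ S : Finset R,
      Submodule.span k (S : Set R) ⊔ (m ^ n).restrictScalars k = ⊤ := by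
    intro n
    induction n with
    | zero => exact ⟨∅, by simp [Ideal.one_eq_top]⟩
    | succ n ih =>
      obtain ⟨S, hS⟩ := ih
      obtain ⟨G, hG⟩ := (IsNoetherian.noetherian (m ^ n) : (m ^ n).FG)
      refine ⟨S ∪ G, ?_⟩
      have hle : (m ^ n).restrictScalars k ≤
          Submodule.span k (G : Set R) ⊔ (m ^ (n + 1)).restrictScalars k := by
        intro x hx
        have hx' : x ∈ Submodule.span R (G : Set R) := by rw [hG]; exact hx
        induction hx' using Submodule.span_induction with
        | mem x h => exact Submodule.mem_sup_left (Submodule.subset_span h)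
        | zero => exact zero_mem _
        | add x y hx1 hy1 h1 h2 =>
          exact add_mem (h1 (by rw [hG] at hx1; exact hx1)) (h2 (by rw [hG] at hy1; exact hy1))
        | smul r x hx1 h1 =>
          have hxm : x ∈ m ^ n := by rw [hG] at hx1; exact hx1
          obtain ⟨c, hc⟩ := hdec r
          have e : r • x = c • x + (r - algebraMap k R c) * x := by
            rw [Algebra.smul_def c x, smul_eq_mul]; ring
          rw [e]
          refine add_mem (Submodule.smul_mem _ c (h1 hxm)) (Submodule.mem_sup_right ?_)
          change _ ∈ m ^ (n + 1)
          rw [pow_succ']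
          exact Ideal.mul_mem_mul hc hxm
      rw [eq_top_iff, ← hS, Finset.coe_union, Submodule.span_union, sup_assoc]
      exact sup_le_sup_left hle _
  obtain ⟨S, hS⟩ := key d
  refine ⟨⟨S.image (Ideal.Quotient.mkₐ k (m ^ d)), ?_⟩⟩
  have h1 := congrArg (Submodule.map (Ideal.Quotient.mkₐ k (m ^ d)).toLinearMap) hS
  rw [Submodule.map_sup, Submodule.map_top, LinearMap.range_eq_top.mpr
    (Ideal.Quotient.mkₐ_surjective k (m ^ d))] at h1
  have h2 : Submodule.map (Ideal.Quotient.mkₐ k (m ^ d)).toLinearMap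
      ((m ^ d).restrictScalars k) = ⊥ := by
    rw [eq_bot_iff]
    rintro _ ⟨x, hx, rfl⟩
    exact Ideal.Quotient.eq_zero_iff_mem.mpr hx
  rw [h2, sup_bot_eq, Submodule.map_span] at h1
  simpa using h1

/-- Elements of `R` whose classes form a `k`-basis of `R / 𝔪 ^ d`. -/
noncomputable def frame (d : ℕ) :
    Fin (Module.finrank k (R ⧸ IsLocalRing.maximalIdeal R ^ d)) → R := fun i =>
  Function.surjInv Ideal.Quotient.mk_surjective
    (Module.finBasis k (R ⧸ IsLocalRing.maximalIdeal R ^ d) i)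

/-- Index set of the Plücker coordinates for `d`-dimensional quotients of `R / 𝔪 ^ d`
(all `d`-tuples of basis vectors, so the coordinates are alternating in the index). -/
abbrev PluckerIndex (d : ℕ) : Type :=
  Fin d → Fin (Module.finrank k (R ⧸ IsLocalRing.maximalIdeal R ^ d))

variable {R}

/-- The Plücker coordinates of the quotient `R → R / I` with respect to a volume form
on the `d`-dimensional space `R / I`. -/
noncomputable def pluckerCoords {d : ℕ} (I : Ideal R) (ω : (R ⧸ I) [⋀^Fin d]→ₗ[k] k) :
    PluckerIndex k R d → k :=
  fun j => ω fun l => Ideal.Quotient.mk I (frame k R d (j l))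

variable {k}

/-- The closed points of the stratum of the punctual Hilbert scheme: the points `[I]` for the ideals
`I` of colength `d` with branch-length vector `a`. Such an ideal contains `𝔪 ^ d`,
so `R / I` is a `d`-dimensional quotient of the vector space `R / 𝔪 ^ d` and `[I]` is its
point on the Grassmannian of these quotients in the Plücker embedding. -/
def hilbStratumPoints {s : ℕ} (φ : Normalization k R s) (d : ℕ) (a : Fin s → ℕ) :
    Set (Proj (coordGrading k (PluckerIndex k R d))) :=
  {x | ∃ I : Ideal R, Module.length R (R ⧸ I) = d ∧ φ.HasBranchLength I a ∧
    ∃ ω : (R ⧸ I) [⋀^Fin d]→ₗ[k] k, ω ≠ 0 ∧ HasHomogeneousCoords x (pluckerCoords k I ω)}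

/-- The stratum of the punctual Hilbert scheme of length `d` subschemes with branch-length
vector `a`, as a (reduced) locally closed subvariety of the Grassmannian of `d`-dimensional
quotients of `R / 𝔪 ^ d`. -/
noncomputable def hilbStratum {s : ℕ} (φ : Normalization k R s) (d : ℕ) (a : Fin s → ℕ) : Var k :=
  subvariety (hilbStratumPoints φ d a)

end Curve

/-!
Let `u` be the element of the normalization whose component along the chosen branch is the
uniformizer and whose other components are `1`. An ideal `I` whose elements have order at least `e`
along that branch satisfies `u I ⊆ R` as soon as `e` is at least the conductor of the branch, so
`I ↦ u I` is a bijection between the two strata, seen as sets of ideals. On the elements of order at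
least `e`, multiplication by `u` agrees with a single `k`-linear embedding of `R` into itself with
one-dimensional cokernel, which identifies `R ⧸ u I` with `k × R ⧸ I`. Hence the Plücker coordinates
`q` of `u I` and `p` of `I` determine each other through two fixed linear maps, `q = T p` and
`p = T' q`. The linear embeddings `p ↦ (p, T p)` and `q ↦ (T' q, q)` of the two projective spaces
into a common one carry both strata onto the same set of points, and a reduced locally closed
subscheme is determined by its points.
-/

section Subschemes

open Limits

variable {X Y Z : Scheme.{u}}

lemma isReduced_vanishingIdeal_subscheme (C : Closeds X) :
    IsReduced (Scheme.IdealSheafData.vanishingIdeal C).subscheme := by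
  refine (IsReduced.iff_of_openCover _
    (Scheme.IdealSheafData.vanishingIdeal C).subschemeCover.openCover).2 fun U => ?_
  refine (affine_isReduced_iff _).2 ?_
  exact (Ideal.isRadical_iff_quotient_reduced _).1 (PrimeSpectrum.isRadical_vanishingIdeal _)

instance (D : Set X) : IsReduced (reducedSubscheme D) :=
  isReduced_vanishingIdeal_subscheme _

lemma range_vanishingIdeal_subschemeι_comp_ι (U : X.Opens) (C : Closeds U) :
    Set.range ((Scheme.IdealSheafData.vanishingIdeal C).subschemeι ≫ U.ι) = U.ι '' C := by
  rw [Scheme.Hom.comp_base, TopCat.coe_comp, Set.range_comp,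
    Scheme.IdealSheafData.range_subschemeι, Scheme.IdealSheafData.coe_support_vanishingIdeal]

lemma range_reducedSubschemeι (D : Set X) :
    Set.range (reducedSubschemeι D) = closure D \ boundaryOf D :=
  (range_vanishingIdeal_subschemeι_comp_ι (complOf D) _).trans <|
    Set.image_preimage_eq_inter_range.trans <| congrArg (closure D ∩ ·) (complOf D).range_ι

lemma isIso_pullback_fst_of_range_eq (f : X ⟶ Z) (g : Y ⟶ Z) [IsImmersion g] [IsReduced X]
    (h : Set.range f ⊆ Set.range g) : IsIso (pullback.fst f g) := by
  have hrange : Set.range (pullback.fst f g) = Set.univ := by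
    rw [Scheme.Pullback.range_fst, Set.preimage_eq_univ_iff]
    exact h
  have : Surjective (pullback.fst f g) := ⟨Set.range_eq_univ.1 hrange⟩
  have : IsClosedImmersion (pullback.fst f g) :=
    IsClosedImmersion.of_isPreimmersion _ (hrange ▸ isClosed_univ)
  exact isIso_of_isClosedImmersion_of_surjective _

lemma exists_iso_of_isImmersion_of_range_eq (f : X ⟶ Z) (g : Y ⟶ Z) [IsImmersion f] [IsImmersion g]
    [IsReduced X] [IsReduced Y] (h : Set.range f = Set.range g) :
    ∃ e : X ≅ Y, e.hom ≫ g = f := by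
  have := isIso_pullback_fst_of_range_eq f g h.subset
  have : IsIso (pullback.snd f g) := by
    have := isIso_pullback_fst_of_range_eq g f h.superset
    rw [← pullbackSymmetry_hom_comp_fst]
    infer_instance
  refine ⟨(asIso (pullback.fst f g)).symm ≪≫ asIso (pullback.snd f g), ?_⟩
  simp [← pullback.condition]

lemma boundaryOf_image (i : X ⟶ Y) [IsClosedImmersion i] (D : Set X) :
    (boundaryOf (i '' D) : Set Y) = i '' boundaryOf D := by
  have hi := i.isClosedEmbedding
  have hclosed (x : X) : IsClosed {i x} ↔ IsClosed {x} := by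
    rw [← Set.image_singleton, hi.isClosed_iff_image_isClosed]
  change closure _ = i '' closure _
  rw [← hi.closure_image_eq, Set.image_sdiff hi.injective, hi.closure_image_eq]
  congr 2
  ext y
  constructor
  · rintro ⟨⟨x, hx, rfl⟩, hy⟩
    exact ⟨x, ⟨hx, (hclosed x).1 hy⟩, rfl⟩
  · rintro ⟨x, ⟨hx, hx'⟩, rfl⟩
    exact ⟨⟨x, hx, rfl⟩, (hclosed x).2 hx'⟩

lemma range_reducedSubschemeι_comp (i : X ⟶ Y) [IsClosedImmersion i] (D : Set X) :
    Set.range (reducedSubschemeι D ≫ i) = Set.range (reducedSubschemeι (i '' D)) := by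
  rw [Scheme.Hom.comp_base, TopCat.coe_comp, Set.range_comp, range_reducedSubschemeι,
    range_reducedSubschemeι, boundaryOf_image, i.isClosedEmbedding.closure_image_eq,
    Set.image_sdiff i.isClosedEmbedding.injective]

lemma exists_iso_reducedSubscheme_of_image_eq (i : X ⟶ Z) (j : Y ⟶ Z) [IsClosedImmersion i]
    [IsClosedImmersion j] {D : Set X} {E : Set Y} (h : i '' D = j '' E) :
    ∃ e : reducedSubscheme D ≅ reducedSubscheme E,
      e.hom ≫ reducedSubschemeι E ≫ j = reducedSubschemeι D ≫ i :=
  exists_iso_of_isImmersion_of_range_eq _ _ <| by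
    rw [range_reducedSubschemeι_comp, range_reducedSubschemeι_comp, h]

end Subschemes

section ProjMap

open HomogeneousLocalization Limits

variable {A B σ τ : Type u} [CommRing A] [SetLike σ A] [AddSubgroupClass σ A]
  [CommRing B] [SetLike τ B] [AddSubgroupClass τ B]
  {𝒜 : ℕ → σ} {ℬ : ℕ → τ} [GradedRing 𝒜] [GradedRing ℬ]

lemma irrelevant_le_map_of_surjective (f : 𝒜 →+*ᵍ ℬ)
    (hsurj : ∀ n, ∀ b ∈ ℬ n, ∃ a ∈ 𝒜 n, f a = b) :
    HomogeneousIdeal.irrelevant ℬ ≤ (HomogeneousIdeal.irrelevant 𝒜).map f := by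
  rw [HomogeneousIdeal.irrelevant_le]
  intro n hn b hb
  obtain ⟨a, ha, rfl⟩ := hsurj n b hb
  exact Ideal.mem_map_of_mem _ (HomogeneousIdeal.mem_irrelevant_of_mem _ hn ha)

lemma awayMap_surjective (f : 𝒜 →+*ᵍ ℬ) (hsurj : ∀ n, ∀ b ∈ ℬ n, ∃ a ∈ 𝒜 n, f a = b)
    {m : ℕ} {s : A} (hs : s ∈ 𝒜 m) : Function.Surjective (Away.map f s) := by
  intro y
  obtain ⟨n, b, hb, rfl⟩ := Away.mk_surjective ℬ (f.2 hs) y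
  obtain ⟨a, ha, rfl⟩ := hsurj _ b hb
  exact ⟨Away.mk 𝒜 hs n a ha, Away.map_mk f _ hs n a ha⟩

lemma isPullback_projMap (f : 𝒜 →+*ᵍ ℬ)
    (hf : HomogeneousIdeal.irrelevant ℬ ≤ (HomogeneousIdeal.irrelevant 𝒜).map f)
    {m : ℕ} (hm : 0 < m) {s : A} (hs : s ∈ 𝒜 m) :
    IsPullback (Spec.map (CommRingCat.ofHom (Away.map f s)))
      (Proj.awayι ℬ (f s) (f.2 hs) hm) (Proj.awayι 𝒜 s hs hm) (Proj.map f hf) :=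
  IsOpenImmersion.isPullback _ _ _ _ (Proj.awayι_comp_map f hf hm s hs) <| by
    rw [Proj.opensRange_awayι, Proj.opensRange_awayι, Proj.map_preimage_basicOpen]

lemma isClosedImmersion_pullback_snd_projMap (f : 𝒜 →+*ᵍ ℬ)
    (hf : HomogeneousIdeal.irrelevant ℬ ≤ (HomogeneousIdeal.irrelevant 𝒜).map f)
    (hsurj : ∀ n, ∀ b ∈ ℬ n, ∃ a ∈ 𝒜 n, f a = b) {m : ℕ} (hm : 0 < m) {s : A} (hs : s ∈ 𝒜 m) :
    IsClosedImmersion (pullback.snd (Proj.map f hf) (Proj.awayι 𝒜 s hs hm)) := by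
  have hsq := (isPullback_projMap f hf hm hs).flip
  rw [← MorphismProperty.cancel_left_of_respectsIso @IsClosedImmersion hsq.isoPullback.hom,
    hsq.isoPullback_hom_snd]
  exact IsClosedImmersion.spec_of_surjective _ (awayMap_surjective f hsurj hs)

lemma isClosedImmersion_projMap (f : 𝒜 →+*ᵍ ℬ)
    (hf : HomogeneousIdeal.irrelevant ℬ ≤ (HomogeneousIdeal.irrelevant 𝒜).map f)
    (hsurj : ∀ n, ∀ b ∈ ℬ n, ∃ a ∈ 𝒜 n, f a = b) :
    IsClosedImmersion (Proj.map f hf) :=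
  IsZariskiLocalAtTarget.of_openCover (P := @IsClosedImmersion)
    (Proj.affineOpenCover 𝒜).openCover fun s =>
      isClosedImmersion_pullback_snd_projMap f hf hsurj s.1.2 s.2.2

end ProjMap

section HomogeneousCoords

variable {k : Type u} [Field k] {σ τ : Type}

attribute [local instance] MvPolynomial.gradedAlgebra

lemma HasHomogeneousCoords.unique {x y : Proj (coordGrading k σ)} {p : σ → k}
    (hx : HasHomogeneousCoords x p) (hy : HasHomogeneousCoords y p) : x = y :=
  ProjectiveSpectrum.ext <| HomogeneousIdeal.ext' fun n f hf => (hx n f hf).trans (hy n f hf).symm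

lemma HasHomogeneousCoords.ne_zero {x : Proj (coordGrading k σ)} {p : σ → k}
    (hx : HasHomogeneousCoords x p) : p ≠ 0 := by
  rintro rfl
  refine ProjectiveSpectrum.not_irrelevant_le x ((HomogeneousIdeal.irrelevant_le _).2 ?_)
  intro n hn f hf
  have hf' : f.IsHomogeneous n := hf
  refine (hx n f hf).2 ?_
  rw [MvPolynomial.eval_zero, MvPolynomial.constantCoeff_eq]
  exact hf'.coeff_eq_zero (by simpa using hn.ne)

lemma exists_hasHomogeneousCoords {p : σ → k} (hp : p ≠ 0) :
    ∃ x : Proj (coordGrading k σ), HasHomogeneousCoords x p := by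
  set I : Ideal (MvPolynomial σ k) := RingHom.ker (MvPolynomial.eval p)
  have hI : I.IsPrime := RingHom.ker_isPrime _
  have hle := Ideal.toIdeal_homogeneousCore_le (coordGrading k σ) I
  refine ⟨⟨I.homogeneousCore (coordGrading k σ), hI.homogeneousCore, fun h => ?_⟩,
    fun n f hf => ⟨fun h => hle h,
      fun h => Ideal.mem_homogeneousCore_of_homogeneous_of_mem (I := I) ⟨n, hf⟩ h⟩⟩
  obtain ⟨j, hj⟩ := Function.ne_iff.1 hp
  have hX : MvPolynomial.X j ∈ coordGrading k σ 1 := MvPolynomial.isHomogeneous_X k j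
  have hXI := hle (h (HomogeneousIdeal.mem_irrelevant_of_mem _ one_pos hX))
  exact hj (by simpa [I] using hXI)

/-- The points of projective space with homogeneous coordinates in `P`. -/
def pointsWithCoords (P : Set (σ → k)) : Set (Proj (coordGrading k σ)) :=
  {x | ∃ p ∈ P, HasHomogeneousCoords x p}

lemma image_pointsWithCoords (i : Proj (coordGrading k σ) ⟶ Proj (coordGrading k τ))
    {S : (σ → k) → τ → k} (hS : S 0 = 0)
    (hi : ∀ x p, HasHomogeneousCoords x p → HasHomogeneousCoords (i x) (S p))
    (P : Set (σ → k)) :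
    i '' pointsWithCoords P = pointsWithCoords (S '' P) := by
  apply subset_antisymm
  · rintro _ ⟨x, ⟨p, hp, hx⟩, rfl⟩
    exact ⟨S p, ⟨p, hp, rfl⟩, hi x p hx⟩
  · rintro y ⟨_, ⟨p, hp, rfl⟩, hy⟩
    obtain ⟨x, hx⟩ := exists_hasHomogeneousCoords (p := p) fun h => hy.ne_zero (by rw [h, hS])
    exact ⟨x, ⟨p, hp, hx⟩, (hi x p hx).unique hy⟩

end HomogeneousCoords

section LinearEmbedding

variable {k : Type u} [Field k] {σ τ : Type} [Fintype σ]

attribute [local instance] MvPolynomial.gradedAlgebra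

/-- The homomorphism of homogeneous coordinate rings `f ↦ f ∘ S` which pulls polynomials back
along the linear map `p ↦ S *ᵥ p`. -/
noncomputable def gradedLinearSubst (S : Matrix τ σ k) :
    coordGrading k τ →+*ᵍ coordGrading k σ where
  toRingHom := (MvPolynomial.bind₁ S.toMvPolynomial).toRingHom
  map_mem {n f} hf := by
    simpa [MvPolynomial.aeval_eq_bind₁] using
      MvPolynomial.IsHomogeneous.aeval hf _ S.toMvPolynomial_isHomogeneous

lemma gradedLinearSubst_apply (S : Matrix τ σ k) (f : MvPolynomial τ k) :
    gradedLinearSubst S f = MvPolynomial.bind₁ S.toMvPolynomial f := rfl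

lemma eval_gradedLinearSubst (S : Matrix τ σ k) (p : σ → k) (f : MvPolynomial τ k) :
    MvPolynomial.eval p (gradedLinearSubst S f) = MvPolynomial.eval (S.mulVec p) f := by
  rw [gradedLinearSubst_apply, MvPolynomial.eval, MvPolynomial.eval₂Hom_bind₁]
  congr 2
  ext t
  exact Matrix.toMvPolynomial_eval_eq_apply S t p

lemma gradedLinearSubst_surjective [Fintype τ] [DecidableEq σ] {S : Matrix τ σ k}
    {L : Matrix σ τ k} (hLS : L * S = 1) (n : ℕ) (b : MvPolynomial σ k)
    (hb : b ∈ coordGrading k σ n) : ∃ a ∈ coordGrading k τ n, gradedLinearSubst S a = b := by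
  refine ⟨gradedLinearSubst L b, (gradedLinearSubst L).2 hb, ?_⟩
  rw [gradedLinearSubst_apply, gradedLinearSubst_apply, MvPolynomial.bind₁_bind₁]
  simp_rw [← Matrix.toMvPolynomial_mul, hLS, Matrix.toMvPolynomial_one]
  exact MvPolynomial.aeval_X_left_apply b

lemma awayι_comp_projMap_comp_projSpaceHom (S : Matrix τ σ k)
    (hirr : HomogeneousIdeal.irrelevant (coordGrading k σ) ≤
      (HomogeneousIdeal.irrelevant (coordGrading k τ)).map (gradedLinearSubst S))
    {n : ℕ} (hn : 0 < n) {f : MvPolynomial τ k} (hf : f ∈ coordGrading k τ n) :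
    Proj.awayι (coordGrading k σ) (gradedLinearSubst S f) ((gradedLinearSubst S).2 hf) hn ≫
        Proj.map (gradedLinearSubst S) hirr ≫ projSpaceHom k τ =
      Proj.awayι (coordGrading k σ) (gradedLinearSubst S f) ((gradedLinearSubst S).2 hf) hn ≫
        projSpaceHom k σ := by
  rw [projSpaceHom, projSpaceHom, Proj.awayι_comp_map_assoc _ _ hn _ hf,
    Proj.awayι_toSpecZero_assoc, Proj.awayι_toSpecZero_assoc, ← Spec.map_comp, ← Spec.map_comp,
    ← Spec.map_comp]
  congr 1
  ext c
  change Localization.mk (MvPolynomial.bind₁ S.toMvPolynomial (algebraMap k _ c))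
      ⟨MvPolynomial.bind₁ S.toMvPolynomial 1, _⟩ =
    Localization.mk (algebraMap k _ c) ⟨1, _⟩
  simp only [map_one, AlgHom.commutes]

lemma exists_closedImmersion_of_mul_eq_one [Fintype τ] [DecidableEq σ] {S : Matrix τ σ k}
    {L : Matrix σ τ k} (hLS : L * S = 1) :
    ∃ i : Proj (coordGrading k σ) ⟶ Proj (coordGrading k τ), IsClosedImmersion i ∧
      i ≫ projSpaceHom k τ = projSpaceHom k σ ∧
      ∀ x p, HasHomogeneousCoords x p → HasHomogeneousCoords (i x) (S.mulVec p) := by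
  have hsurj := gradedLinearSubst_surjective hLS
  have hirr := irrelevant_le_map_of_surjective _ hsurj
  refine ⟨Proj.map (gradedLinearSubst S) hirr, isClosedImmersion_projMap _ _ hsurj, ?_, ?_⟩
  · exact (Proj.mapAffineOpenCover _ hirr).openCover.hom_ext _ _ fun s =>
      awayι_comp_projMap_comp_projSpaceHom S hirr s.1.2 s.2.2
  · intro x p h n f hf
    rw [← eval_gradedLinearSubst]
    exact h n _ ((gradedLinearSubst S).2 hf)

end LinearEmbedding

section Subvarieties

variable {k : Type u} [Field k] {σ τ : Type} [Finite σ] [Finite τ]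

attribute [local instance] MvPolynomial.gradedAlgebra

lemma nonempty_iso_subvariety_of_image_eq {υ : Type} [Finite υ]
    (i : Proj (coordGrading k σ) ⟶ Proj (coordGrading k υ)) [IsClosedImmersion i]
    (hi : i ≫ projSpaceHom k υ = projSpaceHom k σ)
    (j : Proj (coordGrading k τ) ⟶ Proj (coordGrading k υ)) [IsClosedImmersion j]
    (hj : j ≫ projSpaceHom k υ = projSpaceHom k τ)
    {D : Set (Proj (coordGrading k σ))} {E : Set (Proj (coordGrading k τ))} (h : i '' D = j '' E) :
    Nonempty (subvariety D ≅ subvariety E) := by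
  obtain ⟨e, he⟩ := exists_iso_reducedSubscheme_of_image_eq i j h
  refine ⟨(IsVariety k).isoMk (Over.isoMk e ?_)⟩
  change e.hom ≫ reducedSubschemeι E ≫ projSpaceHom k τ =
    reducedSubschemeι D ≫ projSpaceHom k σ
  rw [← hi, ← hj, reassoc_of% he]

lemma nonempty_iso_subvariety_pointsWithCoords {T : (σ → k) →ₗ[k] τ → k}
    {T' : (τ → k) →ₗ[k] σ → k} {P : Set (σ → k)} {P' : Set (τ → k)} (hT : Set.MapsTo T P P')
    (hT' : Set.MapsTo T' P' P) (hinv : Set.InvOn T' T P P') :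
    Nonempty (subvariety (pointsWithCoords P) ≅ subvariety (pointsWithCoords P')) := by
  classical
  cases nonempty_fintype σ
  cases nonempty_fintype τ
  have hS : Matrix.fromCols (1 : Matrix σ σ k) (0 : Matrix σ τ k) *
      Matrix.fromRows (1 : Matrix σ σ k) T.toMatrix' = 1 := by
    simp [Matrix.fromCols_mul_fromRows]
  have hS' : Matrix.fromCols (0 : Matrix τ σ k) (1 : Matrix τ τ k) *
      Matrix.fromRows T'.toMatrix' (1 : Matrix τ τ k) = 1 := by
    simp [Matrix.fromCols_mul_fromRows]
  obtain ⟨i, _, hik, hi⟩ := exists_closedImmersion_of_mul_eq_one hS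
  obtain ⟨j, _, hjk, hj⟩ := exists_closedImmersion_of_mul_eq_one hS'
  simp only [Matrix.fromRows_mulVec, Matrix.one_mulVec, LinearMap.toMatrix'_mulVec] at hi hj
  have himage : (fun p => Sum.elim p (T p)) '' P = (fun q => Sum.elim (T' q) q) '' P' := by
    apply subset_antisymm
    · rintro _ ⟨p, hp, rfl⟩
      exact ⟨T p, hT hp, by simp only [hinv.1 hp]⟩
    · rintro _ ⟨q, hq, rfl⟩
      exact ⟨T' q, hT' hq, by simp only [hinv.2 hq]⟩
  refine nonempty_iso_subvariety_of_image_eq i hik j hjk ?_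
  rw [image_pointsWithCoords i (S := fun p => Sum.elim p (T p)) (by simp) hi,
    image_pointsWithCoords j (S := fun q => Sum.elim (T' q) q) (by simp) hj, himage]

end Subvarieties

section Forms

variable {K V : Type*} [CommRing K] [AddCommGroup V] [Module K V] {n : ℕ}

/-- The exterior product with the first coordinate form, from forms on `V` to forms on `K × V`. -/
noncomputable def prependForm (ω : V [⋀^Fin n]→ₗ[K] K) : (K × V) [⋀^Fin (n + 1)]→ₗ[K] K :=
  .alternatizeUncurryFin
    ((LinearMap.fst K K V).smulRight (ω.compLinearMap (LinearMap.snd K K V)))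

/-- The contraction with the first coordinate vector, from forms on `K × V` to forms on `V`. -/
noncomputable def contractForm (ω : (K × V) [⋀^Fin (n + 1)]→ₗ[K] K) : V [⋀^Fin n]→ₗ[K] K :=
  (ω.curryLeft (1, 0)).compLinearMap (LinearMap.inr K K V)

lemma prependForm_apply (ω : V [⋀^Fin n]→ₗ[K] K) (v : Fin (n + 1) → K × V) :
    prependForm ω v =
      ∑ q : Fin (n + 1), (-1) ^ (q : ℕ) * ((v q).1 * ω fun l => (q.removeNth v l).2) := by
  simp only [prependForm, AlternatingMap.alternatizeUncurryFin_apply, LinearMap.smulRight_apply,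
    AlternatingMap.smul_apply, smul_eq_mul, zsmul_eq_mul, Int.cast_pow, Int.cast_neg,
    Int.cast_one]
  rfl

lemma contractForm_apply (ω : (K × V) [⋀^Fin (n + 1)]→ₗ[K] K) (v : Fin n → V) :
    contractForm ω v = ω (Fin.cons (1, 0) fun l => (0, v l)) := rfl

lemma contractForm_prependForm (ω : V [⋀^Fin n]→ₗ[K] K) : contractForm (prependForm ω) = ω := by
  ext v
  rw [contractForm_apply, prependForm_apply, Fin.sum_univ_succ]
  simp

lemma prependForm_ne_zero {ω : V [⋀^Fin n]→ₗ[K] K} (hω : ω ≠ 0) : prependForm ω ≠ 0 := by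
  contrapose! hω
  rw [← contractForm_prependForm ω, hω]
  rfl

lemma contractForm_injective (b : Module.Basis (Fin n) K V) :
    Function.Injective (contractForm : (K × V) [⋀^Fin (n + 1)]→ₗ[K] K → V [⋀^Fin n]→ₗ[K] K) := by
  let b' : Module.Basis (Fin (n + 1)) K (K × V) :=
    ((Module.Basis.singleton Unit K).prod b).reindex <| (Equiv.sumComm _ _).trans
      ((finSuccEquiv n).trans (Equiv.optionEquivSumPUnit (Fin n))).symm
  have hb' : ⇑b' = Fin.cons (1, 0) fun l => (0, b l) := by
    ext l <;> refine Fin.cases ?_ (fun l => ?_) l <;> simp [b']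
  intro ω ω' h
  rw [← sub_eq_zero, ← AlternatingMap.map_basis_eq_zero_iff b', AlternatingMap.sub_apply, hb',
    ← contractForm_apply, ← contractForm_apply, h, sub_self]

lemma contractForm_ne_zero (b : Module.Basis (Fin n) K V)
    {ω : (K × V) [⋀^Fin (n + 1)]→ₗ[K] K} (hω : ω ≠ 0) : contractForm ω ≠ 0 :=
  (contractForm_injective b).ne hω

lemma prependForm_contractForm (b : Module.Basis (Fin n) K V)
    (ω : (K × V) [⋀^Fin (n + 1)]→ₗ[K] K) : prependForm (contractForm ω) = ω :=
  contractForm_injective b (contractForm_prependForm _)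

end Forms

section Length

open IsLocalRing

variable {R M : Type*} [CommRing R] [IsLocalRing R] [AddCommGroup M] [Module R M]

lemma maximalIdeal_smul_le_of_covBy {N N' : Submodule R M} (h : N ⋖ N') :
    maximalIdeal R • N' ≤ N := by
  have hsimple := (covBy_iff_quot_is_simple h.le).1 h
  rw [← eq_maximalIdeal (IsSimpleModule.annihilator_isMaximal (R := R)
    (M := N' ⧸ N.comap N'.subtype)), Submodule.smul_le]
  intro r hr x hx
  have hrx := Module.mem_annihilator.1 hr (Submodule.Quotient.mk ⟨x, hx⟩)
  rwa [← Submodule.Quotient.mk_smul, Submodule.Quotient.mk_eq_zero] at hrx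

lemma maximalIdeal_pow_smul_top_eq_bot {d : ℕ} (h : Module.length R M = d) :
    maximalIdeal R ^ d • (⊤ : Submodule R M) = ⊥ := by
  obtain ⟨c, hbot, htop⟩ := isFiniteLength_iff_exists_compositionSeries.1
    (Module.length_ne_top_iff.1 (h.trans_ne (ENat.natCast_ne_top d)))
  rw [← Module.length_compositionSeries c hbot htop, Nat.cast_inj] at h
  have hpow (n : Fin (c.length + 1)) : maximalIdeal R ^ (n : ℕ) • c n = ⊥ := by
    induction n using Fin.induction with
    | zero => simpa [RelSeries.head] using hbot
    | succ n ih =>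
      rw [Fin.val_succ, pow_succ, Submodule.mul_smul, eq_bot_iff, ← ih]
      exact smul_mono_right _ (maximalIdeal_smul_le_of_covBy (c.step n))
  simpa [← htop, ← h, RelSeries.last] using hpow (Fin.last _)

lemma maximalIdeal_pow_le_of_length_quotient_eq {I : Ideal R} {d : ℕ}
    (h : Module.length R (R ⧸ I) = d) : maximalIdeal R ^ d ≤ I := by
  intro r hr
  have hr' := Submodule.smul_mem_smul hr (Submodule.mem_top (x := (1 : R ⧸ I)))
  rw [maximalIdeal_pow_smul_top_eq_bot h, Submodule.mem_bot, Algebra.smul_def, mul_one] at hr'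
  exact Ideal.Quotient.eq_zero_iff_mem.1 hr'

variable {k : Type*} [Field k] [Algebra k R] [Module k M] [IsScalarTower k R M]

lemma length_eq_length_of_residue_bijective
    (hres : Function.Bijective (algebraMap k (ResidueField R))) :
    Module.length k M = Module.length R M := by
  have hκ : Module.length (ResidueField k) (ResidueField R) = 1 := by
    rw [← Module.length_eq_of_surjective (residue_surjective (R := k)),
      ← (LinearEquiv.ofBijective (Algebra.linearMap k (ResidueField R)) hres).length_eq,
      Module.length_eq_one]
  rw [IsLocalRing.length_restrictScalars k R M, hκ, mul_one]

lemma nonempty_basis_of_length_eq (hres : Function.Bijective (algebraMap k (ResidueField R)))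
    {d : ℕ} (h : Module.length R M = d) : Nonempty (Module.Basis (Fin d) k M) := by
  rw [← length_eq_length_of_residue_bijective hres] at h
  obtain ⟨_, _⟩ := isFiniteLength_iff_isNoetherian_isArtinian.1
    (Module.length_ne_top_iff.1 (h.trans_ne (ENat.natCast_ne_top d)))
  rw [Module.length_eq_finrank, Nat.cast_inj] at h
  exact ⟨Module.finBasisOfFinrankEq k M h⟩

end Length

lemma length_quotient_eq_iff_eq_maximalIdeal_pow {A : Type*} [CommRing A] [IsDomain A]
    [IsDiscreteValuationRing A] (K : Ideal A) (n : ℕ) :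
    Module.length A (A ⧸ K) = n ↔ K = IsLocalRing.maximalIdeal A ^ n := by
  obtain ⟨m, rfl⟩ := (IsDiscreteValuationRing.idealOrderIsoENat A).symm.surjective K
  induction m using OrderDual.rec with
  | toDual m =>
    rw [Module.length_quotient, Order.coheight_orderIso, Order.coheight_toDual, Order.height_enat,
      ← IsDiscreteValuationRing.idealOrderIsoENat_symm_apply_coe, OrderIso.apply_eq_iff_eq]
    exact OrderDual.toDual_inj.symm

section PowerSeries

open PowerSeries

variable {k : Type*} [Field k]

lemma length_quotient_powerSeries_eq_iff (K : Ideal k⟦X⟧) (n : ℕ) :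
    Module.length k⟦X⟧ (k⟦X⟧ ⧸ K) = n ↔ K = Ideal.span {X ^ n} := by
  rw [← Ideal.span_singleton_pow, ← maximalIdeal_eq_span_X,
    length_quotient_eq_iff_eq_maximalIdeal_pow]

/-- The power series `∑ aₙ₊ₑ Xⁿ` obtained from `∑ aₙ Xⁿ`. -/
noncomputable def seriesTail (e : ℕ) : k⟦X⟧ →ₗ[k] k⟦X⟧ where
  toFun f := PowerSeries.mk fun n => coeff (n + e) f
  map_add' f g := by ext; simp
  map_smul' c f := by ext; simp

@[simp] lemma coeff_seriesTail (e n : ℕ) (f : k⟦X⟧) :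
    coeff n (seriesTail e f) = coeff (n + e) f := by
  simp [seriesTail]

lemma seriesTail_X_pow_mul (e : ℕ) (f : k⟦X⟧) : seriesTail e (X ^ e * f) = f := by
  ext n
  rw [coeff_seriesTail, coeff_X_pow_mul]

lemma seriesTail_eq_iff {e : ℕ} {f g : k⟦X⟧} {c : k} :
    seriesTail e f = c • 1 + X * g ↔ coeff e f = c ∧ seriesTail (e + 1) f = g := by
  constructor
  · intro h
    refine ⟨by simpa using congrArg (coeff 0) h, ?_⟩
    ext n
    simpa [coeff_succ_X_mul, coeff_one, add_assoc, add_comm 1 e] using congrArg (coeff (n + 1)) h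
  · rintro ⟨rfl, rfl⟩
    ext n
    cases n with
    | zero => simp
    | succ n => simp [coeff_succ_X_mul, coeff_one, add_assoc, add_comm 1 e]

end PowerSeries

section CompleteModules

variable {R N : Type*} [CommRing R] [AddCommGroup N] [Module R N] (I : Ideal R)

lemma isPrecomplete_fin_fun [IsPrecomplete I R] (n : ℕ) : IsPrecomplete I (Fin n → R) := by
  refine AdicCompletion.of_surjective_iff.1 fun y => ?_
  choose x hx using fun j =>
    AdicCompletion.of_surjective I R (AdicCompletion.piEquivFin I n y j)
  refine ⟨x, (AdicCompletion.piEquivFin I n).injective (funext fun j => ?_)⟩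
  rw [← hx j, AdicCompletion.piEquivFin_apply]
  exact AdicCompletion.map_of _ _ _

lemma finite_of_finite_quotient_smul_top [IsPrecomplete I R] [IsHausdorff I N]
    [Module.Finite R (N ⧸ (I • ⊤ : Submodule R N))] : Module.Finite R N := by
  obtain ⟨n, f, hf⟩ := Module.Finite.exists_fin' R (N ⧸ (I • ⊤ : Submodule R N))
  obtain ⟨g, hg⟩ := Module.projective_lifting_property (I • ⊤ : Submodule R N).mkQ f
    (Submodule.mkQ_surjective _)
  have := isPrecomplete_fin_fun I n
  exact .of_surjective g (surjective_of_mkQ_comp_surjective (I := I) (hg ▸ hf))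

end CompleteModules

lemma finite_quotient_powerSeries {k : Type*} [Field k] {K : Ideal k⟦X⟧} (hK : K ≠ ⊥) :
    Module.Finite k (k⟦X⟧ ⧸ K) := by
  obtain ⟨n, rfl⟩ := IsDiscreteValuationRing.ideal_eq_span_pow_irreducible hK
    PowerSeries.X_irreducible
  let f : Polynomial.degreeLT k n →ₗ[k] k⟦X⟧ ⧸ Ideal.span {(PowerSeries.X : k⟦X⟧) ^ n} :=
    (Ideal.Quotient.mkₐ k _).toLinearMap ∘ₗ (Polynomial.coeToPowerSeries.algHom k).toLinearMap ∘ₗ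
      Submodule.subtype _
  refine .of_surjective f (Ideal.Quotient.mk_surjective.forall.2 fun g => ?_)
  refine ⟨⟨g.trunc n, Polynomial.mem_degreeLT.2 (PowerSeries.degree_trunc_lt g n)⟩, ?_⟩
  refine (Ideal.Quotient.eq.2 (Ideal.mem_span_singleton.2 ?_)).symm
  nth_rewrite 1 [PowerSeries.eq_X_pow_mul_shift_add_trunc n g]
  simp

lemma apply_ne_zero_of_mem_nonZeroDivisors {ι : Type*} {A : ι → Type*}
    [∀ i, MonoidWithZero (A i)] [∀ i, Nontrivial (A i)] {y : ∀ i, A i}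
    (hy : y ∈ nonZeroDivisors (∀ i, A i)) (i : ι) : y i ≠ 0 := by
  classical
  intro h
  have hy0 : y * Pi.single i 1 = 0 := by rw [← Pi.single_mul_right, h, zero_mul, Pi.single_zero]
  exact Pi.single_ne_zero_iff.2 one_ne_zero ((mem_nonZeroDivisors_iff.1 hy).1 _ hy0)

namespace Normalization

variable {k : Type u} [Field k] {R : Type v} [CommRing R] [Algebra k R] {s : ℕ}
  (φ : Normalization k R s)

lemma exists_mul_mem_range_of_finite {i : Fin s} (hfin : (φ.branch i).Finite) :
    ∃ b : R, φ.branch i b ≠ 0 ∧ ∀ g, Pi.single i (φ.branch i b * g) ∈ φ.toAlgHom.range := by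
  algebraize [φ.branch i]
  suffices h : ∀ N : Submodule R k⟦X⟧, N.FG → ∃ b : R, φ.branch i b ≠ 0 ∧
      ∀ g ∈ N, Pi.single i (φ.branch i b * g) ∈ φ.toAlgHom.range by
    obtain ⟨b, hb, h⟩ := h ⊤ Module.Finite.fg_top
    exact ⟨b, hb, fun g => h g trivial⟩
  have hsmul (r : R) (g : k⟦X⟧) :
      Pi.single i (φ.branch i r * g) = φ.toAlgHom r * Pi.single i g :=
    Pi.single_mul_right _
  refine Submodule.fg_induction (fun g => ?_) fun N₁ N₂ _ _ ⟨b₁, hb₁, h₁⟩ ⟨b₂, hb₂, h₂⟩ => ?_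
  · obtain ⟨a, b, hb, hab⟩ := φ.birational (Pi.single i g)
    refine ⟨b, apply_ne_zero_of_mem_nonZeroDivisors hb i, fun g' hg' => ?_⟩
    obtain ⟨r, rfl⟩ := Submodule.mem_span_singleton.1 hg'
    have hgr : r • g = φ.branch i r * g := rfl
    rw [hgr, mul_left_comm, hsmul, hsmul, hab]
    exact mul_mem ⟨r, rfl⟩ ⟨a, rfl⟩
  · refine ⟨b₁ * b₂, by rw [map_mul]; exact mul_ne_zero hb₁ hb₂, fun g hg => ?_⟩
    obtain ⟨g₁, hg₁, g₂, hg₂, rfl⟩ := Submodule.mem_sup.1 hg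
    have hsum : φ.branch i (b₁ * b₂) * (g₁ + g₂) =
        φ.branch i b₂ * (φ.branch i b₁ * g₁) + φ.branch i b₁ * (φ.branch i b₂ * g₂) := by
      rw [map_mul]
      ring
    rw [hsum, Pi.single_add, hsmul b₁, hsmul b₂]
    exact add_mem (mul_mem ⟨b₂, rfl⟩ (h₁ g₁ hg₁)) (mul_mem ⟨b₁, rfl⟩ (h₂ g₂ hg₂))

section Local

variable [IsLocalRing R]

lemma map_branch_maximalIdeal_le (i : Fin s) :
    (IsLocalRing.maximalIdeal R).map (φ.branch i) ≤ Ideal.span {PowerSeries.X} := by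
  let f : R →+* k := PowerSeries.constantCoeff.comp (φ.branch i)
  have hf : Function.Surjective f := fun c => ⟨algebraMap k R c, by simp [f, branch]⟩
  have hker := IsLocalRing.eq_maximalIdeal (RingHom.ker_isMaximal_of_surjective f hf)
  rw [← hker, Ideal.map_le_iff_le_comap]
  exact fun r hr => Ideal.mem_span_singleton.2 (PowerSeries.X_dvd_iff.2 hr)

lemma map_branch_maximalIdeal_ne_bot (i : Fin s) :
    (IsLocalRing.maximalIdeal R).map (φ.branch i) ≠ ⊥ := by
  obtain ⟨a, b, hb, hab⟩ := φ.birational fun _ => PowerSeries.X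
  have ha : φ.branch i a = φ.toAlgHom b i * PowerSeries.X := (congrFun hab i).symm
  have ham : a ∈ IsLocalRing.maximalIdeal R := fun hu => by
    simpa [ha] using (hu.map (φ.branch i)).map PowerSeries.constantCoeff
  refine Submodule.ne_bot_iff _ |>.2 ⟨_, Ideal.mem_map_of_mem _ ham, ?_⟩
  rw [ha]
  exact mul_ne_zero (apply_ne_zero_of_mem_nonZeroDivisors hb i) PowerSeries.X_ne_zero

lemma finite_branch [IsPrecomplete (IsLocalRing.maximalIdeal R) R] (i : Fin s) :
    (φ.branch i).Finite := by
  algebraize [φ.branch i]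
  have : IsScalarTower k R k⟦X⟧ := .of_algebraMap_eq fun c =>
    (congrFun (φ.toAlgHom.commutes c) i).symm
  have : IsHausdorff (IsLocalRing.maximalIdeal R) k⟦X⟧ :=
    .of_map (φ.map_branch_maximalIdeal_le i)
  have := finite_quotient_powerSeries (φ.map_branch_maximalIdeal_ne_bot i)
  have : Module.Finite R (k⟦X⟧ ⧸ (IsLocalRing.maximalIdeal R • ⊤ : Submodule R k⟦X⟧)) := by
    rw [Ideal.smul_top_eq_map]
    exact .of_restrictScalars_finite k R (k⟦X⟧ ⧸ (IsLocalRing.maximalIdeal R).map (φ.branch i))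
  exact finite_of_finite_quotient_smul_top (IsLocalRing.maximalIdeal R)

lemma exists_mem_conductorIdeal [IsPrecomplete (IsLocalRing.maximalIdeal R) R] (i : Fin s) :
    ∃ c, ∃ r ∈ φ.conductorIdeal, φ.toAlgHom r = Pi.single i (PowerSeries.X ^ c) := by
  obtain ⟨b, hb, h⟩ := φ.exists_mul_mem_range_of_finite (φ.finite_branch i)
  obtain ⟨c, hc⟩ := IsDiscreteValuationRing.ideal_eq_span_pow_irreducible
    (mt Ideal.span_singleton_eq_bot.1 hb) PowerSeries.X_irreducible
  obtain ⟨g, hg⟩ : φ.branch i b ∣ PowerSeries.X ^ c := by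
    rw [← Ideal.mem_span_singleton, hc]
    exact Ideal.mem_span_singleton_self _
  obtain ⟨r, hr⟩ := h g
  refine ⟨c, r, fun y => ?_, hr.trans (by rw [hg])⟩
  have hry : φ.toAlgHom r * y = Pi.single i (φ.branch i b * (g * y i)) := by
    rw [← mul_assoc, Pi.single_mul_left]
    exact congrArg (· * y) hr
  exact hry ▸ h _

lemma exists_eq_single_X_pow_mul [IsPrecomplete (IsLocalRing.maximalIdeal R) R] {i : Fin s} {e : ℕ}
    (he : φ.branchConductor i ≤ e) (g : k⟦X⟧) :
    ∃ r, φ.toAlgHom r = Pi.single i (PowerSeries.X ^ e * g) := by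
  obtain ⟨r, hr, hr'⟩ := Nat.sInf_mem (φ.exists_mem_conductorIdeal i)
  obtain ⟨c, rfl⟩ := Nat.exists_eq_add_of_le he
  obtain ⟨r', h⟩ := hr (Pi.single i (PowerSeries.X ^ c * g))
  refine ⟨r', h.trans ?_⟩
  rw [hr', ← Pi.single_mul, ← mul_assoc, pow_add]
  rfl

end Local

variable {i : Fin s} {e : ℕ}

lemma HasBranchLength.X_pow_dvd {φ : Normalization k R s} {I : Ideal R} {a : Fin s → ℕ}
    (ha : φ.HasBranchLength I a) (i : Fin s) : ∀ r ∈ I, PowerSeries.X ^ a i ∣ φ.branch i r := by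
  intro r hr
  rw [← Ideal.mem_span_singleton, ← (length_quotient_powerSeries_eq_iff _ _).1 (ha i)]
  exact Ideal.mem_map_of_mem _ hr

variable (k) in
/-- The element of the normalization whose `i`-th component is the uniformizer and whose other
components are `1`. -/
noncomputable def branchUniformizer (i : Fin s) : Fin s → k⟦X⟧ :=
  Function.update 1 i PowerSeries.X

/-- The relation `J = u I` between ideals of `R`, where `u` is `branchUniformizer k i`; it is stated
in the normalization, to which `u` belongs. -/
structure IsBranchShift (i : Fin s) (I J : Ideal R) : Prop where
  exists_mem_right : ∀ r ∈ I, ∃ r' ∈ J, φ.toAlgHom r' = branchUniformizer k i * φ.toAlgHom r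
  exists_mem_left : ∀ r' ∈ J, ∃ r ∈ I, φ.toAlgHom r' = branchUniformizer k i * φ.toAlgHom r

namespace IsBranchShift

variable {φ} {I J : Ideal R} (h : φ.IsBranchShift i I J)
include h

lemma map_branch (j : Fin s) :
    J.map (φ.branch j) = Ideal.span {branchUniformizer k i j} * I.map (φ.branch j) := by
  apply le_antisymm
  · refine Ideal.map_le_iff_le_comap.2 fun r' hr' => ?_
    obtain ⟨r, hr, hrr'⟩ := h.exists_mem_left r' hr'
    have hj : φ.branch j r' = branchUniformizer k i j * φ.branch j r := congrFun hrr' j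
    rw [Ideal.mem_comap, hj]
    exact Ideal.mul_mem_mul (Ideal.mem_span_singleton_self _) (Ideal.mem_map_of_mem _ hr)
  · rw [Ideal.span_singleton_mul_le_iff]
    intro f hf
    induction hf using Submodule.span_induction with
    | mem f hf =>
      obtain ⟨r, hr, rfl⟩ := hf
      obtain ⟨r', hr', hrr'⟩ := h.exists_mem_right r hr
      have hj : φ.branch j r' = branchUniformizer k i j * φ.branch j r := congrFun hrr' j
      exact hj ▸ Ideal.mem_map_of_mem _ hr'
    | zero => simp
    | add f g _ _ hf hg => exact mul_add _ f g ▸ add_mem hf hg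
    | smul c f _ hf => exact mul_left_comm c _ f ▸ Ideal.mul_mem_left _ c hf

lemma hasBranchLength_iff (a : Fin s → ℕ) :
    φ.HasBranchLength J (Function.update a i (a i + 1)) ↔ φ.HasBranchLength I a := by
  refine forall_congr' fun j => ?_
  rw [length_quotient_powerSeries_eq_iff, length_quotient_powerSeries_eq_iff, h.map_branch,
    branchUniformizer]
  obtain rfl | hj := eq_or_ne j i
  · rw [Function.update_self, Function.update_self, pow_succ',
      ← Ideal.span_singleton_mul_span_singleton]
    exact (Ideal.span_singleton_mul_right_injective PowerSeries.X_ne_zero).eq_iff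
  · rw [Function.update_of_ne hj, Function.update_of_ne hj, Pi.one_apply, Ideal.span_singleton_one,
      Ideal.top_mul]

end IsBranchShift

section Local

variable [IsLocalRing R] [IsPrecomplete (IsLocalRing.maximalIdeal R) R]

/-- The linear map sending `g` to the element of `R` with `i`-th component `X ^ e * g` and all
other components `0`, which exists when `e` is at least the conductor of the `i`-th branch. -/
noncomputable def liftSingle (he : φ.branchConductor i ≤ e) : k⟦X⟧ →ₗ[k] R :=
  (LinearEquiv.ofInjective φ.toAlgHom.toLinearMap φ.injective).symm.toLinearMap ∘ₗ
    LinearMap.codRestrict _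
      (LinearMap.single k (fun _ : Fin s => k⟦X⟧) i ∘ₗ LinearMap.mulLeft k (PowerSeries.X ^ e))
      (φ.exists_eq_single_X_pow_mul he)

lemma map_liftSingle (he : φ.branchConductor i ≤ e) (g : k⟦X⟧) :
    φ.toAlgHom (φ.liftSingle he g) = Pi.single i (PowerSeries.X ^ e * g) :=
  congrArg Subtype.val (LinearEquiv.apply_symm_apply
    (LinearEquiv.ofInjective φ.toAlgHom.toLinearMap φ.injective) _)

lemma branch_liftSingle (he : φ.branchConductor i ≤ e) (g : k⟦X⟧) :
    φ.branch i (φ.liftSingle he g) = PowerSeries.X ^ e * g :=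
  (congrFun (φ.map_liftSingle he g) i).trans (Pi.single_eq_same i _)

lemma seriesTail_branch_add_liftSingle (he : φ.branchConductor i ≤ e) (r : R) (g : k⟦X⟧) :
    seriesTail e (φ.branch i (r + φ.liftSingle he g)) = seriesTail e (φ.branch i r) + g := by
  rw [map_add, branch_liftSingle, map_add, seriesTail_X_pow_mul]

/-- The branch as a linear map. -/
noncomputable def branchₗ (i : Fin s) : R →ₗ[k] k⟦X⟧ :=
  LinearMap.proj i ∘ₗ φ.toAlgHom.toLinearMap

/-- For an element `r` of order at least `e` on the `i`-th branch, `(0, r)` corresponds to the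
element obtained from `r` by multiplying the `i`-th component by the uniformizer. This
multiplication is extended to a linear embedding of `R` into itself by writing the `i`-th component
as `f + X ^ e * g` with `f` of degree less than `e` and replacing it by `f + X ^ (e + 1) * g`; the
`e`-th coefficient of the `i`-th component is a coordinate on the cokernel. -/
noncomputable def shiftEquiv (he : φ.branchConductor i ≤ e) : R ≃ₗ[k] k × R where
  toLinearMap := (PowerSeries.coeff e ∘ₗ φ.branchₗ i).prod
    (LinearMap.id + φ.liftSingle he ∘ₗ (seriesTail (e + 1) - seriesTail e) ∘ₗ φ.branchₗ i)
  invFun x := x.2 +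
    φ.liftSingle he (x.1 • 1 + (PowerSeries.X - 1) * seriesTail e (φ.branch i x.2))
  left_inv r := by
    set t := seriesTail e (φ.branch i r)
    set t' := seriesTail (e + 1) (φ.branch i r)
    have ht : t = PowerSeries.coeff e (φ.branch i r) • 1 + PowerSeries.X * t' :=
      seriesTail_eq_iff.2 ⟨rfl, rfl⟩
    have ht' : seriesTail e (φ.branch i (r + φ.liftSingle he (t' - t))) = t' := by
      rw [seriesTail_branch_add_liftSingle, add_sub_cancel]
    change r + φ.liftSingle he (t' - t) +
      φ.liftSingle he (PowerSeries.coeff e (φ.branch i r) • 1 + (PowerSeries.X - 1) *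
        seriesTail e (φ.branch i (r + φ.liftSingle he (t' - t)))) = r
    rw [ht', sub_one_mul, ← add_sub_assoc, ← ht, add_assoc, ← map_add, sub_add_sub_cancel',
      sub_self, map_zero, add_zero]
  right_inv := fun (c, r) => by
    set t := seriesTail e (φ.branch i r)
    set g := c • 1 + (PowerSeries.X - 1) * t with hg
    have ht : seriesTail e (φ.branch i (r + φ.liftSingle he g)) = c • 1 + PowerSeries.X * t := by
      rw [seriesTail_branch_add_liftSingle, hg]
      ring
    obtain ⟨hc, ht'⟩ := seriesTail_eq_iff.1 ht
    refine Prod.ext hc ?_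
    change r + φ.liftSingle he g + φ.liftSingle he
      (seriesTail (e + 1) (φ.branch i (r + φ.liftSingle he g)) -
        seriesTail e (φ.branch i (r + φ.liftSingle he g))) = r
    have hcancel : g + (t - (c • 1 + PowerSeries.X * t)) = 0 := by
      rw [hg]
      ring
    rw [ht', ht, add_assoc, ← map_add, hcancel, map_zero, add_zero]

lemma shiftEquiv_apply (he : φ.branchConductor i ≤ e) (r : R) :
    φ.shiftEquiv he r = (PowerSeries.coeff e (φ.branch i r), r + φ.liftSingle he
      (seriesTail (e + 1) (φ.branch i r) - seriesTail e (φ.branch i r))) :=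
  rfl

lemma shiftEquiv_symm_apply (he : φ.branchConductor i ≤ e) (x : k × R) :
    (φ.shiftEquiv he).symm x = x.2 +
      φ.liftSingle he (x.1 • 1 + (PowerSeries.X - 1) * seriesTail e (φ.branch i x.2)) :=
  rfl

lemma map_shiftEquiv_symm_zero (he : φ.branchConductor i ≤ e) {r : R}
    (hr : PowerSeries.X ^ e ∣ φ.branch i r) :
    φ.toAlgHom ((φ.shiftEquiv he).symm (0, r)) = branchUniformizer k i * φ.toAlgHom r := by
  obtain ⟨f, hf⟩ := hr
  rw [shiftEquiv_symm_apply, map_add, map_liftSingle, hf, seriesTail_X_pow_mul]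
  ext1 j
  obtain rfl | hj := eq_or_ne j i
  · have hβ : φ.toAlgHom r j = PowerSeries.X ^ e * f := hf
    simp only [Pi.add_apply, Pi.mul_apply, Pi.single_eq_same, branchUniformizer,
      Function.update_self, hβ, zero_smul]
    ring
  · simp [hj, branchUniformizer]

lemma map_eq_mul_map_shiftEquiv_snd (he : φ.branchConductor i ≤ e) {r : R}
    (hr : PowerSeries.X ^ (e + 1) ∣ φ.branch i r) :
    φ.toAlgHom r = branchUniformizer k i * φ.toAlgHom (φ.shiftEquiv he r).2 := by
  obtain ⟨f, hf⟩ := hr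
  rw [shiftEquiv_apply, map_add, map_liftSingle, hf, seriesTail_X_pow_mul]
  ext1 j
  obtain rfl | hj := eq_or_ne j i
  · have hβ : φ.toAlgHom r j = PowerSeries.X ^ (e + 1) * f := hf
    simp only [Pi.add_apply, Pi.mul_apply, Pi.single_eq_same, branchUniformizer,
      Function.update_self, hβ]
    rw [pow_succ, mul_assoc, seriesTail_X_pow_mul]
    ring
  · simp [hj, branchUniformizer]

variable {φ}

lemma exists_isBranchShift_right (he : φ.branchConductor i ≤ e) {I : Ideal R}
    (hI : ∀ r ∈ I, PowerSeries.X ^ e ∣ φ.branch i r) : ∃ J, φ.IsBranchShift i I J := by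
  refine ⟨{
    carrier := {r' | ∃ r ∈ I, φ.toAlgHom r' = branchUniformizer k i * φ.toAlgHom r}
    zero_mem' := ⟨0, zero_mem _, by simp⟩
    add_mem' := ?_
    smul_mem' := ?_ }, fun r hr => ?_, fun _ hr' => hr'⟩
  · rintro _ _ ⟨r₁, hr₁, h₁⟩ ⟨r₂, hr₂, h₂⟩
    exact ⟨r₁ + r₂, add_mem hr₁ hr₂, by rw [map_add, h₁, h₂, map_add, mul_add]⟩
  · rintro c _ ⟨r, hr, h⟩
    exact ⟨c * r, I.mul_mem_left c hr, by rw [smul_eq_mul, map_mul, h, map_mul, mul_left_comm]⟩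
  · have h := φ.map_shiftEquiv_symm_zero he (hI r hr)
    exact ⟨_, ⟨r, hr, h⟩, h⟩

lemma exists_isBranchShift_left (he : φ.branchConductor i ≤ e) {J : Ideal R}
    (hJ : ∀ r ∈ J, PowerSeries.X ^ (e + 1) ∣ φ.branch i r) : ∃ I, φ.IsBranchShift i I J := by
  refine ⟨{
    carrier := {r | ∃ r' ∈ J, φ.toAlgHom r' = branchUniformizer k i * φ.toAlgHom r}
    zero_mem' := ⟨0, zero_mem _, by simp⟩
    add_mem' := ?_
    smul_mem' := ?_ }, fun _ hr => hr, fun r' hr' => ?_⟩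
  · rintro _ _ ⟨r₁, hr₁, h₁⟩ ⟨r₂, hr₂, h₂⟩
    exact ⟨r₁ + r₂, add_mem hr₁ hr₂, by rw [map_add, h₁, h₂, map_add, mul_add]⟩
  · rintro c _ ⟨r, hr, h⟩
    exact ⟨c * r, J.mul_mem_left c hr, by rw [smul_eq_mul, map_mul, h, map_mul, mul_left_comm]⟩
  · have h := φ.map_eq_mul_map_shiftEquiv_snd he (hJ r' hr')
    exact ⟨_, ⟨r', hr', h⟩, h⟩

lemma IsBranchShift.mem_right_iff {I J : Ideal R} (h : φ.IsBranchShift i I J)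
    (he : φ.branchConductor i ≤ e) (hI : ∀ r ∈ I, PowerSeries.X ^ e ∣ φ.branch i r) (r : R) :
    r ∈ J ↔ (φ.shiftEquiv he r).1 = 0 ∧ (φ.shiftEquiv he r).2 ∈ I := by
  constructor
  · intro hr
    obtain ⟨r₀, hr₀, hr₀r⟩ := h.exists_mem_left r hr
    rw [← φ.map_shiftEquiv_symm_zero he (hI r₀ hr₀)] at hr₀r
    rw [φ.injective hr₀r, LinearEquiv.apply_symm_apply]
    exact ⟨rfl, hr₀⟩
  · rintro ⟨h₁, h₂⟩
    obtain ⟨r', hr', hrr'⟩ := h.exists_mem_right _ h₂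
    rw [← φ.map_shiftEquiv_symm_zero he (hI _ h₂), ← h₁, Prod.mk.eta,
      LinearEquiv.symm_apply_apply] at hrr'
    exact φ.injective hrr' ▸ hr'

end Local

end Normalization

section QuotientByLine

variable {k R : Type*} [CommRing k] [CommRing R] [Algebra k R] {T : R ≃ₗ[k] k × R} {I J : Ideal R}
  (h : ∀ r, r ∈ J ↔ (T r).1 = 0 ∧ (T r).2 ∈ I)

/-- The isomorphism `R ⧸ J ≃ k × R ⧸ I` induced by an isomorphism `R ≃ k × R` under which `J`
corresponds to `0 × I`. -/
noncomputable def quotientEquiv : (R ⧸ J) ≃ₗ[k] k × (R ⧸ I) :=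
  let f : R →ₗ[k] k × (R ⧸ I) :=
    LinearMap.id.prodMap (Ideal.Quotient.mkₐ k I).toLinearMap ∘ₗ T.toLinearMap
  have hker : J.restrictScalars k = LinearMap.ker f := by
    ext r
    simp [f, h, Ideal.Quotient.eq_zero_iff_mem]
  have hf : Function.Surjective f :=
    (Function.surjective_id.prodMap Ideal.Quotient.mk_surjective).comp T.surjective
  (Submodule.Quotient.restrictScalarsEquiv k J).symm ≪≫ₗ
    Submodule.quotEquivOfEq _ _ hker ≪≫ₗ f.quotKerEquivOfSurjective hf

lemma quotientEquiv_mk (r : R) :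
    quotientEquiv h (Ideal.Quotient.mk J r) = ((T r).1, Ideal.Quotient.mk I (T r).2) :=
  rfl

lemma quotientEquiv_symm_mk (c : k) (r : R) :
    (quotientEquiv h).symm (c, Ideal.Quotient.mk I r) = Ideal.Quotient.mk J (T.symm (c, r)) := by
  rw [LinearEquiv.symm_apply_eq, quotientEquiv_mk, LinearEquiv.apply_symm_apply]

end QuotientByLine

section Plucker

variable {k : Type u} [Field k] {R : Type v} [CommRing R] [Algebra k R] [IsCurveSingularity k R]
  {d : ℕ}

lemma mk_eq_sum_repr_smul_frame {I : Ideal R} (hI : IsLocalRing.maximalIdeal R ^ d ≤ I) (r : R) :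
    Ideal.Quotient.mk I r = ∑ j, (Module.finBasis k (R ⧸ IsLocalRing.maximalIdeal R ^ d)).repr
      (Ideal.Quotient.mk _ r) j • Ideal.Quotient.mk I (frame k R d j) := by
  have h := (Module.finBasis k (R ⧸ IsLocalRing.maximalIdeal R ^ d)).sum_repr
    (Ideal.Quotient.mk _ r)
  have hframe (j) : Ideal.Quotient.mk (IsLocalRing.maximalIdeal R ^ d) (frame k R d j) =
      Module.finBasis k (R ⧸ IsLocalRing.maximalIdeal R ^ d) j :=
    Function.surjInv_eq Ideal.Quotient.mk_surjective _
  simp only [← hframe] at h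
  simpa using (congrArg (Ideal.Quotient.factorₐ k hI) h).symm

/-- The linear combination of Plücker coordinates that gives the value of the volume form at the
classes of `v`. -/
noncomputable def pluckerEval (v : Fin d → R) : (PluckerIndex k R d → k) →ₗ[k] k :=
  ∑ j : PluckerIndex k R d, (∏ l, (Module.finBasis k (R ⧸ IsLocalRing.maximalIdeal R ^ d)).repr
    (Ideal.Quotient.mk _ (v l)) (j l)) • LinearMap.proj j

lemma pluckerEval_pluckerCoords {I : Ideal R} (hI : Module.length R (R ⧸ I) = d)
    (ω : (R ⧸ I) [⋀^Fin d]→ₗ[k] k) (v : Fin d → R) :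
    pluckerEval v (pluckerCoords k I ω) = ω fun l => Ideal.Quotient.mk I (v l) := by
  rw [funext fun l => mk_eq_sum_repr_smul_frame (k := k)
    (maximalIdeal_pow_le_of_length_quotient_eq hI) (v l)]
  refine Eq.trans ?_ (MultilinearMap.map_sum ω.toMultilinearMap _).symm
  simp only [pluckerEval, LinearMap.sum_apply, LinearMap.smul_apply, LinearMap.proj_apply]
  exact Finset.sum_congr rfl fun j _ => (MultilinearMap.map_smul_univ _ _ _).symm

variable (T : R ≃ₗ[k] k × R)

/-- The linear map that computes the Plücker coordinates of `J` from those of `I` when `T` carries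
`J` to `0 × I`. -/
noncomputable def pluckerMap (d : ℕ) :
    (PluckerIndex k R d → k) →ₗ[k] PluckerIndex k R (d + 1) → k :=
  LinearMap.pi fun j => ∑ q : Fin (d + 1), ((-1) ^ (q : ℕ) * (T (frame k R (d + 1) (j q))).1) •
    pluckerEval fun l => (T (frame k R (d + 1) (q.removeNth j l))).2

/-- The linear map that computes the Plücker coordinates of `I` from those of `J` when `T` carries
`J` to `0 × I`. -/
noncomputable def pluckerMapInv (d : ℕ) :
    (PluckerIndex k R (d + 1) → k) →ₗ[k] PluckerIndex k R d → k :=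
  LinearMap.pi fun j =>
    pluckerEval (Fin.cons (T.symm (1, 0)) fun l => T.symm (0, frame k R d (j l)))

variable {T} {I J : Ideal R} (h : ∀ r, r ∈ J ↔ (T r).1 = 0 ∧ (T r).2 ∈ I)
include h

lemma length_quotient_eq_iff_length_quotient_eq_add_one :
    Module.length R (R ⧸ I) = d ↔ Module.length R (R ⧸ J) = (d + 1 : ℕ) := by
  have hres := IsCurveSingularity.residue_bijective (k := k) (R := R)
  rw [← length_eq_length_of_residue_bijective hres, ← length_eq_length_of_residue_bijective hres,
    (quotientEquiv h).length_eq, Module.length_prod, Module.length_eq_one k k, add_comm,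
    Nat.cast_succ]
  exact (ENat.add_left_injective_of_ne_top ENat.one_ne_top).eq_iff.symm

lemma pluckerMap_pluckerCoords (hI : Module.length R (R ⧸ I) = d) (ω : (R ⧸ I) [⋀^Fin d]→ₗ[k] k) :
    pluckerMap T d (pluckerCoords k I ω) =
      pluckerCoords k J ((prependForm ω).compLinearMap (quotientEquiv h).toLinearMap) := by
  ext j
  simp only [pluckerMap, LinearMap.pi_apply, LinearMap.sum_apply, LinearMap.smul_apply,
    pluckerEval_pluckerCoords hI, smul_eq_mul, mul_assoc, pluckerCoords,
    AlternatingMap.compLinearMap_apply, prependForm_apply]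
  rfl

lemma pluckerMapInv_pluckerCoords (hJ : Module.length R (R ⧸ J) = (d + 1 : ℕ))
    (ω : (R ⧸ J) [⋀^Fin (d + 1)]→ₗ[k] k) :
    pluckerMapInv T d (pluckerCoords k J ω) =
      pluckerCoords k I (contractForm (ω.compLinearMap (quotientEquiv h).symm.toLinearMap)) := by
  ext j
  rw [pluckerMapInv, LinearMap.pi_apply, pluckerEval_pluckerCoords hJ, pluckerCoords,
    contractForm_apply, AlternatingMap.compLinearMap_apply]
  congr 1
  ext1 l
  refine Fin.cases ?_ (fun l => ?_) l
  · exact (quotientEquiv_symm_mk h 1 0).symm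
  · exact (quotientEquiv_symm_mk h 0 _).symm

lemma pluckerMapInv_pluckerMap_pluckerCoords (hI : Module.length R (R ⧸ I) = d)
    (ω : (R ⧸ I) [⋀^Fin d]→ₗ[k] k) :
    pluckerMapInv T d (pluckerMap T d (pluckerCoords k I ω)) = pluckerCoords k I ω := by
  have hJ := (length_quotient_eq_iff_length_quotient_eq_add_one h).1 hI
  rw [pluckerMap_pluckerCoords h hI, pluckerMapInv_pluckerCoords h hJ,
    AlternatingMap.compLinearMap_assoc, LinearEquiv.comp_symm, AlternatingMap.compLinearMap_id,
    contractForm_prependForm]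

lemma pluckerMap_pluckerMapInv_pluckerCoords (hJ : Module.length R (R ⧸ J) = (d + 1 : ℕ))
    (ω : (R ⧸ J) [⋀^Fin (d + 1)]→ₗ[k] k) :
    pluckerMap T d (pluckerMapInv T d (pluckerCoords k J ω)) = pluckerCoords k J ω := by
  have hI := (length_quotient_eq_iff_length_quotient_eq_add_one h).2 hJ
  obtain ⟨b⟩ := nonempty_basis_of_length_eq
    (IsCurveSingularity.residue_bijective (k := k) (R := R)) hI
  rw [pluckerMapInv_pluckerCoords h hJ, pluckerMap_pluckerCoords h hI, prependForm_contractForm b,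
    AlternatingMap.compLinearMap_assoc, LinearEquiv.symm_comp, AlternatingMap.compLinearMap_id]

omit h

/-- The Plücker coordinates of the ideals of colength `d` in `𝓘`. -/
def pluckerVectors (k : Type u) [Field k] [Algebra k R] [IsCurveSingularity k R] (d : ℕ)
    (𝓘 : Set (Ideal R)) : Set (PluckerIndex k R d → k) :=
  {p | ∃ I ∈ 𝓘, Module.length R (R ⧸ I) = d ∧
    ∃ ω : (R ⧸ I) [⋀^Fin d]→ₗ[k] k, ω ≠ 0 ∧ pluckerCoords k I ω = p}

variable {𝓘 𝓙 : Set (Ideal R)}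

lemma mapsTo_pluckerMap (h𝓘 : ∀ I ∈ 𝓘, ∃ J ∈ 𝓙, ∀ r, r ∈ J ↔ (T r).1 = 0 ∧ (T r).2 ∈ I) :
    Set.MapsTo (pluckerMap T d) (pluckerVectors k d 𝓘) (pluckerVectors k (d + 1) 𝓙) := by
  rintro _ ⟨I, hI, hd, ω, hω, rfl⟩
  obtain ⟨J, hJ, h⟩ := h𝓘 I hI
  rw [pluckerMap_pluckerCoords h hd]
  exact ⟨J, hJ, (length_quotient_eq_iff_length_quotient_eq_add_one h).1 hd, _,
    (AlternatingMap.compLinearEquiv_eq_zero_iff _ _).not.2 (prependForm_ne_zero hω), rfl⟩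

lemma mapsTo_pluckerMapInv (h𝓙 : ∀ J ∈ 𝓙, ∃ I ∈ 𝓘, ∀ r, r ∈ J ↔ (T r).1 = 0 ∧ (T r).2 ∈ I) :
    Set.MapsTo (pluckerMapInv T d) (pluckerVectors k (d + 1) 𝓙) (pluckerVectors k d 𝓘) := by
  rintro _ ⟨J, hJ, hd, ω, hω, rfl⟩
  obtain ⟨I, hI, h⟩ := h𝓙 J hJ
  have hdI := (length_quotient_eq_iff_length_quotient_eq_add_one h).2 hd
  obtain ⟨b⟩ := nonempty_basis_of_length_eq
    (IsCurveSingularity.residue_bijective (k := k) (R := R)) hdI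
  rw [pluckerMapInv_pluckerCoords h hd]
  exact ⟨I, hI, hdI, _,
    contractForm_ne_zero b ((AlternatingMap.compLinearEquiv_eq_zero_iff _ _).not.2 hω), rfl⟩

lemma nonempty_iso_subvariety_pluckerVectors
    (h𝓘 : ∀ I ∈ 𝓘, ∃ J ∈ 𝓙, ∀ r, r ∈ J ↔ (T r).1 = 0 ∧ (T r).2 ∈ I)
    (h𝓙 : ∀ J ∈ 𝓙, ∃ I ∈ 𝓘, ∀ r, r ∈ J ↔ (T r).1 = 0 ∧ (T r).2 ∈ I) :
    Nonempty (subvariety (pointsWithCoords (pluckerVectors k d 𝓘)) ≅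
      subvariety (pointsWithCoords (pluckerVectors k (d + 1) 𝓙))) := by
  refine nonempty_iso_subvariety_pointsWithCoords (mapsTo_pluckerMap h𝓘)
    (mapsTo_pluckerMapInv h𝓙) ⟨?_, ?_⟩
  · rintro _ ⟨I, hI, hd, ω, -, rfl⟩
    obtain ⟨J, -, h⟩ := h𝓘 I hI
    exact pluckerMapInv_pluckerMap_pluckerCoords h hd ω
  · rintro _ ⟨J, hJ, hd, ω, -, rfl⟩
    obtain ⟨I, -, h⟩ := h𝓙 J hJ
    exact pluckerMap_pluckerMapInv_pluckerCoords h hd ω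

lemma hilbStratumPoints_eq_pointsWithCoords {s : ℕ} (φ : Normalization k R s) (d : ℕ)
    (a : Fin s → ℕ) :
    hilbStratumPoints φ d a =
      pointsWithCoords (pluckerVectors k d {I | φ.HasBranchLength I a}) := by
  ext x
  constructor
  · rintro ⟨I, hd, ha, ω, hω, hx⟩
    exact ⟨_, ⟨I, ha, hd, ω, hω, rfl⟩, hx⟩
  · rintro ⟨_, ⟨I, ha, hd, ω, hω, rfl⟩, hx⟩
    exact ⟨I, hd, ha, ω, hω, hx⟩

end Plucker

lemma K0Var.mk_eq_of_iso {k : Type u} [Field k] {X Y : Var k} (f : X ≅ Y) :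
    K0Var.mk X = K0Var.mk Y := by
  rw [K0Var.mk, K0Var.mk, PreK0.of, PreK0.of, congr_toSkeleton_of_iso f]

theorem theorem5p1_general {k : Type u} [Field k] {R : Type v} [CommRing R] [Algebra k R]
    [IsCurveSingularity k R] {s : ℕ} (φ : Normalization k R s) (i : Fin s) (d : ℕ) (a : Fin s → ℕ)
    (ha : φ.branchConductor i ≤ a i) :
    Nonempty (hilbStratum φ d a ≅ hilbStratum φ (d + 1) (Function.update a i (a i + 1))) := by
  have := IsCurveSingularity.isAdicComplete (k := k) (R := R)
  rw [hilbStratum, hilbStratum, hilbStratumPoints_eq_pointsWithCoords,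
    hilbStratumPoints_eq_pointsWithCoords]
  refine nonempty_iso_subvariety_pluckerVectors (T := φ.shiftEquiv ha) (fun I hI => ?_)
    fun J hJ => ?_
  · obtain ⟨J, h⟩ := Normalization.exists_isBranchShift_right ha (hI.X_pow_dvd i)
    exact ⟨J, (h.hasBranchLength_iff a).2 hI, h.mem_right_iff ha (hI.X_pow_dvd i)⟩
  · obtain ⟨I, h⟩ := Normalization.exists_isBranchShift_left ha
      (by simpa using hJ.X_pow_dvd i)
    have hI := (h.hasBranchLength_iff a).1 hJ
    exact ⟨I, hI, h.mem_right_iff ha (hI.X_pow_dvd i)⟩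

theorem theorem5p1 {k : Type u} [Field k] [IsAlgClosed k]
    {R : Type v} [CommRing R] [Algebra k R] [IsCurveSingularity k R]
    {s : ℕ} (φ : Normalization k R (s + 1)) (a' : Fin s → ℕ) (d e : ℕ)
    (he : φ.branchConductor (Fin.last s) ≤ e) :
    K0Var.mk (hilbStratum φ d (Fin.snoc a' e)) =
      K0Var.mk (hilbStratum φ (d + 1) (Fin.snoc a' (e + 1))) := by
  obtain ⟨f⟩ := theorem5p1_general φ (Fin.last s) d (Fin.snoc a' e) (by simpa using he)
  rw [Fin.snoc_last, Fin.update_snoc_last] at f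
  exact K0Var.mk_eq_of_iso f
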